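/- Let $\Omega=[0,1]^d$ and $\sigma(t)=t/(1+e^{-t})$ (swish). Fix a depth $L\ge 1$, layer dimensions $d_0=d,d_1,\dots,d_{L-1},d_L=1$ and $B_\Theta>0$, and let $\mathcal F$ be the class of all realizations $v(\cdot;\theta)=T_L\circ\sigma\circ T_{L-1}\circ\cdots\circ\sigma\circ T_1$, where $\sigma$ acts componentwise, $T_i(s)=A_is+b_i$ with $A_i\in\mathbb R^{d_i\times d_{i-1}}$, $b_i\in\mathbb R^{d_i}$, and the vector $\theta$ of all entries of the $A_i,b_i$ satisfies $\|\theta\|_{\ell_\infty}\le B_\Theta$. Let $X_1,X_2,\dots\in[0,1]^d$ be a low-discrepancy sequence, that is, the star discrepancy (with respect to the boxes $\prod_i[0,b_i)$, $b\in[0,1]^d$) of its first $n$ points is $O(n^{-1}(\log n)^d)$ as $n\to\infty$. (i) (Poisson problem $-\Delta u=f$ with Neumann boundary condition.) Let $f\in C^d(\Omega)$ and $$\mathcal L(u)=\int_\Omega\Big(\tfrac12\|\nabla u\|_{\ell_2}^2-fu\Big)dx+\tfrac12\Big(\int_\Omega u\,dx\Big)^2,$$ $$\mathcal L_n(u)=\frac1n\sum_{j=1}^n\Big(\tfrac12\|\nabla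 u(X_j)\|_{\ell_2}^2-f(X_j)u(X_j)\Big)+\tfrac12\Big(\frac1n\sum_{j=1}^nu(X_j)\Big)^2.$$ Then $\mathcal L$ and, for each $n\ge2$, $\mathcal L_n$ attain their minima over $\mathcal F$, and there is a constant $\mu_1>0$ independent of $n$ such that, for every $n\ge 2$, every minimizer $u_n$ of $\mathcal L_n$ over $\mathcal F$ and every minimizer $u_{\mathcal F}$ of $\mathcal L$ over $\mathcal F$, $$|\mathcal L(u_n)-\mathcal L_n(u_n)|\le\mu_1 n^{-1}(\log n)^d\quad\text{and}\quad|\mathcal L(u_{\mathcal F})-\mathcal L_n(u_{\mathcal F})|\le\mu_1 n^{-1}(\log n)^d.$$ (ii) (Static Schrödinger problem $-\Delta u+Vu=g$ with Neumann boundary condition.) Let $V,g\in C^d(\Omega)$ and $$\mathcal L(u)=\int_\Omega\Big(\tfrac12\|\nabla u\|_{\ell_2}^2+\tfrac12V|u|^2-gu\Big)dx,$$ $$\mathcal L_n(u)=\frac1n\sum_{j=1}^n\Big(\tfrac12\|\nabla u(X_j)\|_{\ell_2}^2-g(X_j)u(X_j)+\tfrac12V(X_j)|u(X_j)|^2\Big).$$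 Then the minima are again attained, and the same two bounds hold, for every $n\ge2$ and all minimizers $u_n,u_{\mathcal F}$, with a constant $\mu_2>0$ independent of $n$. -/

import Mathlib

open MeasureTheory Filter Asymptotics

noncomputable section

/-- The closed unit cube `[0,1]^d` in Euclidean space. -/
def unitCube (d : ℕ) : Set (EuclideanSpace ℝ (Fin d)) :=
  {x | ∀ i, 0 ≤ x i ∧ x i ≤ 1}

/-- The swish activation function `t / (1 + exp (-t))`. -/
def swish (t : ℝ) : ℝ := t / (1 + Real.exp (-t))

/-- The shape of a fully connected network with input dimension `d` and one output. The depth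
(number of affine maps) is `hidden + 1`, and the layer dimensions are
`width 0 = d, width 1, …, width (hidden + 1) = 1`; later values of `width` play no role. -/
structure NetShape (d : ℕ) where
  hidden : ℕ
  width : ℕ → ℕ
  width_zero : width 0 = d
  width_last : width (hidden + 1) = 1

namespace NetShape

variable {d : ℕ}

/-- The positions of the weights: for every layer `i`, the entries of the matrix (left summand)
and of the bias vector (right summand). A weight vector is a function on this finite type. -/
abbrev WeightIndex (S : NetShape d) : Type :=
  Σ i : Fin (S.hidden + 1), (Fin (S.width (i + 1)) × Fin (S.width i)) ⊕ Fin (S.width (i + 1))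

/-- The affine map `s ↦ A s + b` of layer `i` (layers are counted from `0`). -/
def affineLayer (S : NetShape d) (θ : S.WeightIndex → ℝ) (i : ℕ) (hi : i < S.hidden + 1)
    (s : Fin (S.width i) → ℝ) : Fin (S.width (i + 1)) → ℝ :=
  fun r => ∑ c, θ ⟨⟨i, hi⟩, Sum.inl (r, c)⟩ * s c + θ ⟨⟨i, hi⟩, Sum.inr r⟩

/-- The value after the affine map of layer `i`; the activation function is applied
componentwise between consecutive affine maps. -/
def preactivation (S : NetShape d) (θ : S.WeightIndex → ℝ) (x : Fin (S.width 0) → ℝ) :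
    (i : ℕ) → i < S.hidden + 1 → Fin (S.width (i + 1)) → ℝ
  | 0, hi => S.affineLayer θ 0 hi x
  | i + 1, hi => S.affineLayer θ (i + 1) hi
      (fun c => swish (S.preactivation θ x i (Nat.lt_of_succ_lt hi) c))

/-- The realization `v(x; θ)`: the only component of the last affine map. -/
def realization (S : NetShape d) (θ : S.WeightIndex → ℝ) (x : EuclideanSpace ℝ (Fin d)) : ℝ :=
  S.preactivation θ (fun i => x (Fin.cast S.width_zero i)) S.hidden (Nat.lt_succ_self _)
    ⟨0, by rw [S.width_last]; exact Nat.one_pos⟩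

/-- The network class: all realizations with weights bounded by `B` in the sup norm
(the norm of a function type is the sup norm). -/
def netClass (S : NetShape d) (B : ℝ) : Set (EuclideanSpace ℝ (Fin d) → ℝ) :=
  {v | ∃ θ : S.WeightIndex → ℝ, ‖θ‖ ≤ B ∧ v = S.realization θ}

end NetShape

/-- The loss functional of the Poisson problem with right-hand side `f`. -/
def poissonLoss {d : ℕ} (f u : EuclideanSpace ℝ (Fin d) → ℝ) : ℝ :=
  (∫ x in unitCube d, (1 / 2 * ‖gradient u x‖ ^ 2 - f x * u x))
    + 1 / 2 * (∫ x in unitCube d, u x) ^ 2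

/-- The loss functional of the static Schrödinger problem with potential `V` and
right-hand side `g`. -/
def schrodingerLoss {d : ℕ} (V g u : EuclideanSpace ℝ (Fin d) → ℝ) : ℝ :=
  ∫ x in unitCube d, (1 / 2 * ‖gradient u x‖ ^ 2 + 1 / 2 * V x * |u x| ^ 2 - g x * u x)

/-- The empirical Poisson loss on the first `n` points of `X`. -/
def empiricalPoissonLoss {d : ℕ} (X : ℕ → EuclideanSpace ℝ (Fin d)) (n : ℕ)
    (f u : EuclideanSpace ℝ (Fin d) → ℝ) : ℝ :=
  1 / (n : ℝ) * ∑ j ∈ Finset.range n, (1 / 2 * ‖gradient u (X j)‖ ^ 2 - f (X j) * u (X j))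
    + 1 / 2 * (1 / (n : ℝ) * ∑ j ∈ Finset.range n, u (X j)) ^ 2

/-- The empirical Schrödinger loss on the first `n` points of `X`. -/
def empiricalSchrodingerLoss {d : ℕ} (X : ℕ → EuclideanSpace ℝ (Fin d)) (n : ℕ)
    (V g u : EuclideanSpace ℝ (Fin d) → ℝ) : ℝ :=
  1 / (n : ℝ) * ∑ j ∈ Finset.range n,
    (1 / 2 * ‖gradient u (X j)‖ ^ 2 - g (X j) * u (X j) + 1 / 2 * V (X j) * |u (X j)| ^ 2)

/-- The set of minimizers of `J` over `s`. -/
def argminOn {α : Type*} (J : α → ℝ) (s : Set α) : Set α :=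
  {u | u ∈ s ∧ ∀ v ∈ s, J u ≤ J v}

open Classical in
/-- The star discrepancy of the first `n` points of `X`: the supremum, over the boxes
`∏ i, [0, b i)` with `b ∈ [0,1]^d`, of the difference between the proportion of points in the
box and its volume. -/
def starDiscrepancy {d : ℕ} (X : ℕ → EuclideanSpace ℝ (Fin d)) (n : ℕ) : ℝ :=
  ⨆ b : Set.Icc (0 : Fin d → ℝ) 1,
    |(((Finset.range n).filter (fun j => ∀ i, 0 ≤ X j i ∧ X j i < b.1 i)).card : ℝ) / n
      - ∏ i, b.1 i|

/-- Low-discrepancy sequences in `[0,1]^d`. -/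
def IsLowDiscrepancy {d : ℕ} (X : ℕ → EuclideanSpace ℝ (Fin d)) : Prop :=
  (∀ j, X j ∈ unitCube d) ∧
    (fun n : ℕ => starDiscrepancy X n) =O[atTop]
      (fun n : ℕ => (n : ℝ)⁻¹ * Real.log n ^ d)

end

/-! The two estimates hold for every network in the class, with one constant, and so for all
minimizers. The integrands are jointly $C^d$ in weights and input: swish is smooth, so the network
and its squared gradient norm are smooth, and the data are $C^d$ on the cube. Mixed derivatives that
use each coordinate at most once are therefore bounded uniformly for weights in a closed ball, which
is compact. This gives a Koksma–Hlawka inequality uniform in the weights,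
`exists_bound_integral_sub_average`.

Its core, `exists_bound_setIntegral_sub_lowerBox`, compares two finite measures that nearly agree on
all boxes $\prod_i[0,b_i)$. By the fundamental theorem of calculus, $G(x)$ is its value at $x_i=1$
minus $\int_{x_i}^1\partial_iG\,dt$. After Fubini, the condition $x_i<t$ merely shortens one side of
the box (`setIntegral_lowerBox_insert`). Induction over the coordinates ends with constant
integrands, where only the masses of lower boxes are compared.

The squared mean in the Poisson loss is handled by factoring a difference of squares. Minimizers
exist because the losses are continuous in the weights (`nonempty_argminOn_netClass`). -/

/-- The half-open box `∏ i, [0, b i)`. -/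
def lowerBox {d : ℕ} (b : Fin d → ℝ) : Set (Fin d → ℝ) :=
  Set.univ.pi fun i => Set.Ico 0 (b i)

/-! ### Lower boxes and points of the cube with modified coordinates. -/

section LowerBox

variable {d : ℕ}

lemma measurableSet_lowerBox (b : Fin d → ℝ) : MeasurableSet (lowerBox b) :=
  MeasurableSet.univ_pi fun _ => measurableSet_Ico

lemma lowerBox_subset_Icc {b : Fin d → ℝ} (hb : b ∈ Set.Icc (0 : Fin d → ℝ) 1) :
    lowerBox b ⊆ Set.Icc 0 1 := fun _ hx =>
  ⟨fun i => (hx i trivial).1, fun i => (hx i trivial).2.le.trans (hb.2 i)⟩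

/-- Lower boxes are stable under such cuts, so the Fubini step never leaves the family of sets that
the discrepancy controls. -/
lemma lowerBox_inter_coord_lt {b : Fin d → ℝ} {i : Fin d} {t : ℝ} (ht : t ≤ b i) :
    lowerBox b ∩ {x | x i < t} = lowerBox (Function.update b i t) := by
  ext x
  simp only [lowerBox, Set.mem_inter_iff, Set.mem_univ_pi, Set.mem_Ico, Set.mem_ofPred_eq]
  constructor
  · rintro ⟨h, hi⟩ j
    refine ⟨(h j).1, ?_⟩
    by_cases hj : j = i
    · subst hj; simpa using hi
    · simpa [hj] using (h j).2
  · intro h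
    have hi : x i < t := by simpa using (h i).2
    refine ⟨fun j => ⟨(h j).1, ?_⟩, hi⟩
    by_cases hj : j = i
    · subst hj; exact hi.trans_le ht
    · simpa [hj] using (h j).2

lemma update_mem_Icc_zero_one {y : Fin d → ℝ} (hy : y ∈ Set.Icc (0 : Fin d → ℝ) 1) (i : Fin d)
    {t : ℝ} (ht : t ∈ Set.Icc (0 : ℝ) 1) :
    Function.update y i t ∈ Set.Icc (0 : Fin d → ℝ) 1 := by
  constructor <;> intro j <;> by_cases hj : j = i
  · subst hj; simpa using ht.1
  · simpa [hj] using hy.1 j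
  · subst hj; simpa using ht.2
  · simpa [hj] using hy.2 j

lemma piecewise_mem_Icc_zero_one (s : Finset (Fin d)) {x y : Fin d → ℝ}
    (hx : x ∈ Set.Icc (0 : Fin d → ℝ) 1) (hy : y ∈ Set.Icc (0 : Fin d → ℝ) 1) :
    s.piecewise x y ∈ Set.Icc (0 : Fin d → ℝ) 1 := by
  constructor <;> intro j <;> by_cases hj : j ∈ s
  · simpa [hj] using hx.1 j
  · simpa [hj] using hy.1 j
  · simpa [hj] using hx.2 j
  · simpa [hj] using hy.2 j

/-- The data are smooth only on the closed cube, so all derivatives are taken within it; this makes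
them unique. -/
lemma uniqueDiffOn_univ_prod_Icc (P : Type*) [NormedAddCommGroup P] [NormedSpace ℝ P] :
    UniqueDiffOn ℝ ((Set.univ : Set P) ×ˢ Set.Icc (0 : Fin d → ℝ) 1) := by
  refine uniqueDiffOn_univ.prod ?_
  rw [← Set.pi_univ_Icc]
  exact UniqueDiffOn.univ_pi fun i => uniqueDiffOn_Icc zero_lt_one

end LowerBox

/-! ### Integrability when the coordinates in `s` vary and the others are fixed at `y`. -/

section FrozenCoordinates

variable {d : ℕ} {P : Type*}

lemma continuousOn_comp_piecewise [TopologicalSpace P] {G : P × (Fin d → ℝ) → ℝ}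
    (hG : ContinuousOn G (Set.univ ×ˢ Set.Icc 0 1)) (θ : P) (s : Finset (Fin d))
    {y : Fin d → ℝ} (hy : y ∈ Set.Icc (0 : Fin d → ℝ) 1) :
    ContinuousOn (fun x => G (θ, s.piecewise x y)) (Set.Icc 0 1) := by
  refine hG.comp (Continuous.continuousOn ?_)
    fun x hx => ⟨trivial, piecewise_mem_Icc_zero_one s hx hy⟩
  refine continuous_const.prodMk (continuous_pi fun j => ?_)
  by_cases hj : j ∈ s
  · simpa [hj] using continuous_apply j
  · simpa [hj] using continuous_const

lemma integrableOn_comp_piecewise [TopologicalSpace P] {G : P × (Fin d → ℝ) → ℝ}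
    (hG : ContinuousOn G (Set.univ ×ˢ Set.Icc 0 1)) (θ : P) (s : Finset (Fin d))
    {y : Fin d → ℝ} (hy : y ∈ Set.Icc (0 : Fin d → ℝ) 1) {b : Fin d → ℝ}
    (hb : b ∈ Set.Icc (0 : Fin d → ℝ) 1) (ν : Measure (Fin d → ℝ)) [IsFiniteMeasure ν] :
    IntegrableOn (fun x => G (θ, s.piecewise x y)) (lowerBox b) ν :=
  ((continuousOn_comp_piecewise hG θ s hy).integrableOn_compact isCompact_Icc).mono_set
    (lowerBox_subset_Icc hb)

/-- The indicator encodes the lower limit $x_i$ of the $t$-integral, so that Fubini applies on a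
product set. -/
lemma integrable_indicator_coord_lt [TopologicalSpace P] {H : P × (Fin d → ℝ) → ℝ}
    (hH : ContinuousOn H (Set.univ ×ˢ Set.Icc 0 1)) (θ : P) (s : Finset (Fin d)) (i : Fin d)
    {y : Fin d → ℝ} (hy : y ∈ Set.Icc (0 : Fin d → ℝ) 1) {b : Fin d → ℝ}
    (hb : b ∈ Set.Icc (0 : Fin d → ℝ) 1) (ν : Measure (Fin d → ℝ)) [IsFiniteMeasure ν] :
    Integrable ({q : (Fin d → ℝ) × ℝ | q.1 i < q.2}.indicator
      fun q => H (θ, s.piecewise q.1 (Function.update y i q.2)))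
      ((ν.restrict (lowerBox b)).prod (volume.restrict (Set.Ioc (0 : ℝ) 1))) := by
  refine Integrable.indicator ?_
    (measurableSet_lt ((measurable_pi_apply i).comp measurable_fst) measurable_snd)
  rw [Measure.prod_restrict]
  have hcont : ContinuousOn (fun q : (Fin d → ℝ) × ℝ =>
      H (θ, s.piecewise q.1 (Function.update y i q.2))) (Set.Icc 0 1 ×ˢ Set.Icc 0 1) := by
    refine hH.comp (Continuous.continuousOn ?_) fun q hq => ⟨trivial,
      piecewise_mem_Icc_zero_one s hq.1 (update_mem_Icc_zero_one hy i hq.2)⟩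
    refine continuous_const.prodMk (continuous_pi fun j => ?_)
    by_cases hj : j ∈ s
    · simpa [hj] using (continuous_apply j).comp' continuous_fst
    · simpa [hj] using (continuous_apply j).comp'
        ((continuous_const (y := y)).update i continuous_snd)
  exact (hcont.integrableOn_compact (isCompact_Icc.prod isCompact_Icc)).mono_set
    (Set.prod_mono (lowerBox_subset_Icc hb) Set.Ioc_subset_Icc_self)

lemma setIntegral_indicator_coord_lt (H : P × (Fin d → ℝ) → ℝ) (θ : P) (s : Finset (Fin d))
    (i : Fin d) (y : Fin d → ℝ) {b : Fin d → ℝ} {t : ℝ} (ht : t ≤ b i)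
    (ν : Measure (Fin d → ℝ)) :
    ∫ x in lowerBox b, {q : (Fin d → ℝ) × ℝ | q.1 i < q.2}.indicator
      (fun q => H (θ, s.piecewise q.1 (Function.update y i q.2))) (x, t) ∂ν
    = ∫ x in lowerBox (Function.update b i t), H (θ, s.piecewise x (Function.update y i t)) ∂ν := by
  rw [← lowerBox_inter_coord_lt ht,
    ← setIntegral_indicator (measurableSet_lt (measurable_pi_apply i) measurable_const)]
  rfl

/-- Integrability in `t` over a moving box is read off from Fubini for the indicator form. -/
lemma integrableOn_setIntegral_lowerBox_update [TopologicalSpace P] {H : P × (Fin d → ℝ) → ℝ}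
    (hH : ContinuousOn H (Set.univ ×ˢ Set.Icc 0 1)) (θ : P) (s : Finset (Fin d)) (i : Fin d)
    {y : Fin d → ℝ} (hy : y ∈ Set.Icc (0 : Fin d → ℝ) 1) {b : Fin d → ℝ}
    (hb : b ∈ Set.Icc (0 : Fin d → ℝ) 1) (hbi : b i = 1)
    (ν : Measure (Fin d → ℝ)) [IsFiniteMeasure ν] :
    IntegrableOn (fun t => ∫ x in lowerBox (Function.update b i t),
      H (θ, s.piecewise x (Function.update y i t)) ∂ν) (Set.Ioc 0 1) := by
  refine (integrable_indicator_coord_lt hH θ s i hy hb ν).integral_prod_right.congr ?_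
  filter_upwards [ae_restrict_mem measurableSet_Ioc] with t ht
  exact setIntegral_indicator_coord_lt H θ s i y (ht.2.trans hbi.ge) ν

end FrozenCoordinates

/-! ### Induction over the coordinates: fundamental theorem of calculus and Fubini. -/

section Variation

variable {d : ℕ} {P : Type*} [NormedAddCommGroup P] [NormedSpace ℝ P]

/-- The partial derivative in the `i`-th coordinate of the cube of a function on the product of a
parameter space and the cube. -/
noncomputable def coordDeriv (i : Fin d) (G : P × (Fin d → ℝ) → ℝ) (p : P × (Fin d → ℝ)) : ℝ :=
  fderivWithin ℝ G (Set.univ ×ˢ Set.Icc 0 1) p (0, Pi.single i 1)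

lemma ContDiffOn.coordDeriv {m : ℕ} {G : P × (Fin d → ℝ) → ℝ}
    (hG : ContDiffOn ℝ (m + 1 : ℕ) G (Set.univ ×ˢ Set.Icc 0 1)) (i : Fin d) :
    ContDiffOn ℝ m (coordDeriv i G) (Set.univ ×ˢ Set.Icc 0 1) :=
  (hG.fderivWithin (uniqueDiffOn_univ_prod_Icc P) (by norm_cast)).clm_apply contDiffOn_const

lemma sub_eq_setIntegral_coordDeriv {m : ℕ} {G : P × (Fin d → ℝ) → ℝ}
    (hG : ContDiffOn ℝ (m + 1 : ℕ) G (Set.univ ×ˢ Set.Icc 0 1)) (i : Fin d) (θ : P)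
    {z : Fin d → ℝ} (hz : z ∈ Set.Icc (0 : Fin d → ℝ) 1) {a : ℝ} (ha : a ∈ Set.Icc (0 : ℝ) 1) :
    G (θ, Function.update z i 1) - G (θ, Function.update z i a)
      = ∫ t in Set.Ioc a 1, coordDeriv i G (θ, Function.update z i t) := by
  have hcurve : Continuous fun t : ℝ => (θ, Function.update z i t) :=
    continuous_const.prodMk (continuous_const.update i continuous_id)
  have hmaps : Set.MapsTo (fun t : ℝ => (θ, Function.update z i t)) (Set.Icc a 1)
      ((Set.univ : Set P) ×ˢ Set.Icc (0 : Fin d → ℝ) 1) := fun t ht =>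
    ⟨trivial, update_mem_Icc_zero_one hz i ⟨ha.1.trans ht.1, ht.2⟩⟩
  rw [← intervalIntegral.integral_of_le ha.2]
  refine (intervalIntegral.integral_eq_sub_of_hasDeriv_right_of_le
    (f := fun t => G (θ, Function.update z i t)) ha.2
    (hG.continuousOn.comp hcurve.continuousOn hmaps) (fun t ht => ?_) ?_).symm
  · have h1 : HasFDerivWithinAt G (fderivWithin ℝ G (Set.univ ×ˢ Set.Icc 0 1)
        (θ, Function.update z i t)) (Set.univ ×ˢ Set.Icc 0 1) (θ, Function.update z i t) :=
      (hG.differentiableOn (by simp) _ (hmaps ⟨ht.1.le, ht.2.le⟩)).hasFDerivWithinAt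
    have h2 : HasDerivWithinAt (fun t : ℝ => (θ, Function.update z i t))
        ((0 : P), Pi.single i (1 : ℝ)) (Set.Icc a 1) t :=
      ((hasDerivAt_const t θ).prodMk (hasDerivAt_update z i t)).hasDerivWithinAt
    have h3 := h1.comp_hasDerivWithinAt t h2 hmaps
    exact h3.mono_of_mem_nhdsWithin
      (mem_nhdsWithin_of_mem_nhds (Icc_mem_nhds ht.1 ht.2))
  · refine ContinuousOn.intervalIntegrable ?_
    rw [Set.uIcc_of_le ha.2]
    exact (hG.coordDeriv i).continuousOn.comp hcurve.continuousOn hmaps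

/-- Splitting off one coordinate: the integral over a box is expressed by values on the face where
the coordinate is `1` and by integrals of the partial derivative over smaller boxes. -/
lemma setIntegral_lowerBox_insert {m : ℕ} {G : P × (Fin d → ℝ) → ℝ}
    (hG : ContDiffOn ℝ (m + 1 : ℕ) G (Set.univ ×ˢ Set.Icc 0 1)) (θ : P) {s : Finset (Fin d)}
    {i : Fin d} (hi : i ∉ s) {y : Fin d → ℝ} (hy : y ∈ Set.Icc (0 : Fin d → ℝ) 1)
    {b : Fin d → ℝ} (hb : b ∈ Set.Icc (0 : Fin d → ℝ) 1) (hbi : b i = 1)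
    (ν : Measure (Fin d → ℝ)) [IsFiniteMeasure ν] :
    ∫ x in lowerBox b, G (θ, (insert i s).piecewise x y) ∂ν
      = ∫ x in lowerBox b, G (θ, s.piecewise x (Function.update y i 1)) ∂ν
        - ∫ t in Set.Ioc 0 1, ∫ x in lowerBox (Function.update b i t),
            coordDeriv i G (θ, s.piecewise x (Function.update y i t)) ∂ν := by
  have hH := (hG.coordDeriv i).continuousOn
  have hone := update_mem_Icc_zero_one hy i (t := 1) ⟨zero_le_one, le_rfl⟩
  rw [eq_sub_iff_add_eq, add_comm, ← eq_sub_iff_add_eq,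
    ← integral_sub (integrableOn_comp_piecewise hG.continuousOn θ s hone hb ν)
      (integrableOn_comp_piecewise hG.continuousOn θ _ hy hb ν)]
  have hinner : ∀ x ∈ lowerBox b, G (θ, s.piecewise x (Function.update y i 1))
      - G (θ, (insert i s).piecewise x y) = ∫ t in Set.Ioc 0 1,
        {q : (Fin d → ℝ) × ℝ | q.1 i < q.2}.indicator
          (fun q => coordDeriv i G (θ, s.piecewise q.1 (Function.update y i q.2))) (x, t) := by
    intro x hx
    have hx01 := lowerBox_subset_Icc hb hx
    -- Enlarging the interval of integration to $(0,1]$ moves the dependence on `x` into the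
    -- indicator.
    have hset : Set.Ioc (x i) 1 = Set.Ioc 0 1 ∩ Set.Ioi (x i) := by
      ext t
      constructor
      · exact fun h => ⟨⟨(hx01.1 i).trans_lt h.1, h.2⟩, h.1⟩
      · exact fun h => ⟨h.2, h.1.2⟩
    rw [Finset.piecewise_insert, ← Finset.update_piecewise_of_notMem _ _ _ hi,
      sub_eq_setIntegral_coordDeriv hG i θ (piecewise_mem_Icc_zero_one s hx01 hy)
        ⟨hx01.1 i, hx01.2 i⟩, hset, ← setIntegral_indicator measurableSet_Ioi]
    congr 1
    ext t
    by_cases ht : x i < t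
    · simp [Set.indicator, ht, Finset.update_piecewise_of_notMem _ _ _ hi]
    · simp [Set.indicator, ht]
  rw [setIntegral_congr_fun (measurableSet_lowerBox b) hinner]
  rw [integral_integral_swap (f := fun x t => {q : (Fin d → ℝ) × ℝ | q.1 i < q.2}.indicator
    (fun q => coordDeriv i G (θ, s.piecewise q.1 (Function.update y i q.2))) (x, t))
    (integrable_indicator_coord_lt hH θ s i hy hb ν)]
  refine setIntegral_congr_fun measurableSet_Ioc fun t ht => ?_
  exact (setIntegral_indicator_coord_lt _ θ s i y (ht.2.trans hbi.ge) ν).symm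

/-- A uniform Koksma–Hlawka inequality for functions with frozen coordinates: the coordinates
outside `s` are parameters. -/
lemma exists_bound_setIntegral_sub_lowerBox {K : Set P} (hK : IsCompact K)
    (s : Finset (Fin d)) : ∀ G : P × (Fin d → ℝ) → ℝ,
      ContDiffOn ℝ s.card G (Set.univ ×ˢ Set.Icc 0 1) → ∃ C : ℝ, 0 ≤ C ∧
      ∀ (ν₁ ν₂ : Measure (Fin d → ℝ)) [IsFiniteMeasure ν₁] [IsFiniteMeasure ν₂] (D : ℝ),
        (∀ b ∈ Set.Icc (0 : Fin d → ℝ) 1, |ν₁.real (lowerBox b) - ν₂.real (lowerBox b)| ≤ D) →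
        ∀ θ ∈ K, ∀ y ∈ Set.Icc (0 : Fin d → ℝ) 1, ∀ b ∈ Set.Icc (0 : Fin d → ℝ) 1,
          (∀ i ∈ s, b i = 1) →
          |∫ x in lowerBox b, G (θ, s.piecewise x y) ∂ν₁
            - ∫ x in lowerBox b, G (θ, s.piecewise x y) ∂ν₂| ≤ C * D := by
  induction s using Finset.induction_on with
  | empty =>
    intro G hG
    obtain ⟨C, hC⟩ := (hK.prod (isCompact_Icc (a := (0 : Fin d → ℝ)) (b := 1))
      ).exists_bound_of_continuousOn
      (hG.continuousOn.mono (Set.prod_mono_left (Set.subset_univ K)))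
    -- With every coordinate frozen the integrand is the constant `G (θ, y)`, and the two integrals
    -- differ by it times the difference of the masses.
    refine ⟨max C 0, le_max_right _ _, fun ν₁ ν₂ _ _ D hD θ hθ y hy b hb _ => ?_⟩
    simp only [Finset.piecewise_empty, setIntegral_const, smul_eq_mul]
    rw [← sub_mul, abs_mul, mul_comm]
    exact mul_le_mul ((hC (θ, y) ⟨hθ, hy⟩).trans (le_max_left _ _)) (hD b hb) (abs_nonneg _)
      (le_max_right _ _)
  | insert i s hi ih =>
    intro G hG
    rw [Finset.card_insert_of_notMem hi] at hG
    obtain ⟨C₁, hC₁, h₁⟩ := ih G (hG.of_le (by norm_cast; omega))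
    obtain ⟨C₂, hC₂, h₂⟩ := ih _ (hG.coordDeriv i)
    -- `C₁` serves the face $x_i=1$ and `C₂` the partial derivative; the outer integral costs no
    -- factor, as $(0,1]$ has length one.
    refine ⟨C₁ + C₂, add_nonneg hC₁ hC₂, fun ν₁ ν₂ _ _ D hD θ hθ y hy b hb hbs => ?_⟩
    have hbi : b i = 1 := hbs i (Finset.mem_insert_self i s)
    have hH := (hG.coordDeriv i).continuousOn
    rw [setIntegral_lowerBox_insert hG θ hi hy hb hbi ν₁,
      setIntegral_lowerBox_insert hG θ hi hy hb hbi ν₂, sub_sub_sub_comm, add_mul]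
    refine (abs_sub _ _).trans (add_le_add ?_ ?_)
    · exact h₁ ν₁ ν₂ D hD θ hθ _ (update_mem_Icc_zero_one hy i ⟨zero_le_one, le_rfl⟩) b hb
        fun j hj => hbs j (Finset.mem_insert_of_mem hj)
    · rw [← integral_sub (integrableOn_setIntegral_lowerBox_update hH θ s i hy hb hbi ν₁)
        (integrableOn_setIntegral_lowerBox_update hH θ s i hy hb hbi ν₂)]
      have hle := norm_setIntegral_le_of_norm_le_const (μ := volume) (s := Set.Ioc (0 : ℝ) 1)
        (C := C₂ * D) (f := fun t => ∫ x in lowerBox (Function.update b i t),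
            coordDeriv i G (θ, s.piecewise x (Function.update y i t)) ∂ν₁
          - ∫ x in lowerBox (Function.update b i t),
            coordDeriv i G (θ, s.piecewise x (Function.update y i t)) ∂ν₂) (by simp)
        fun t ht => by
          refine h₂ ν₁ ν₂ D hD θ hθ _ (update_mem_Icc_zero_one hy i ⟨ht.1.le, ht.2⟩) _
            (update_mem_Icc_zero_one hb i ⟨ht.1.le, ht.2⟩) fun j hj => ?_
          -- Only side `i` is shortened, and `i ∉ s`, so the sides in `s` still have length one.
          rw [Function.update_of_ne (ne_of_mem_of_not_mem hj hi)]
          exact hbs j (Finset.mem_insert_of_mem hj)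
      simpa using hle

end Variation

/-! ### Star discrepancy as a distance between the empirical measure and volume. -/

section Discrepancy

variable {d : ℕ}

/-- The uniform probability measure on the first `n` terms of a sequence. -/
noncomputable def empiricalMeasure {α : Type*} [MeasurableSpace α] (x : ℕ → α) (n : ℕ) :
    Measure α :=
  (n : NNReal)⁻¹ • ∑ j ∈ Finset.range n, Measure.dirac (x j)

lemma setIntegral_empiricalMeasure {α : Type*} [MeasurableSpace α] [MeasurableSingletonClass α]
    (x : ℕ → α) (n : ℕ) (f : α → ℝ) {s : Set α} (hs : MeasurableSet s) :
    ∫ a in s, f a ∂(empiricalMeasure x n)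
      = 1 / (n : ℝ) * ∑ j ∈ Finset.range n, s.indicator f (x j) := by
  rw [← integral_indicator hs, empiricalMeasure, integral_smul_nnreal_measure,
    integral_finsetSum_measure fun j _ => integrable_dirac (by simp)]
  simp [NNReal.smul_def]

instance {α : Type*} [MeasurableSpace α] (x : ℕ → α) (n : ℕ) :
    IsFiniteMeasure (empiricalMeasure x n) := by
  unfold empiricalMeasure
  infer_instance

open Classical in
lemma abs_empiricalMeasure_sub_volume_lowerBox_le (X : ℕ → EuclideanSpace ℝ (Fin d)) (n : ℕ)
    {b : Fin d → ℝ} (hb : b ∈ Set.Icc (0 : Fin d → ℝ) 1) :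
    |(empiricalMeasure (fun j => (X j).ofLp) n).real (lowerBox b)
      - (volume.restrict (Set.Icc (0 : Fin d → ℝ) 1)).real (lowerBox b)|
      ≤ starDiscrepancy X n := by
  have hvol : (volume.restrict (Set.Icc (0 : Fin d → ℝ) 1)).real (lowerBox b) = ∏ i, b i := by
    rw [measureReal_restrict_apply' measurableSet_Icc,
      Set.inter_eq_left.2 (lowerBox_subset_Icc hb)]
    have := Real.volume_pi_Ico_toReal hb.1
    simpa [lowerBox, Measure.real] using this
  have hcard : (empiricalMeasure (fun j => (X j).ofLp) n).real (lowerBox b)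
      = (((Finset.range n).filter (fun j => ∀ i, 0 ≤ X j i ∧ X j i < b i)).card : ℝ) / n := by
    have h := setIntegral_empiricalMeasure (fun j => (X j).ofLp) n (fun _ => 1)
      (measurableSet_lowerBox b)
    rw [setIntegral_const, smul_eq_mul, mul_one] at h
    rw [h, one_div_mul_eq_div, Finset.card_filter]
    simp [Set.indicator, lowerBox]
  rw [hvol, hcard]
  -- The real supremum dominates its terms only if they are bounded above; proportions and volumes
  -- lie in $[0,1]$, so `1` is a bound.
  refine le_ciSup (f := fun b : Set.Icc (0 : Fin d → ℝ) 1 =>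
    |(((Finset.range n).filter (fun j => ∀ i, 0 ≤ X j i ∧ X j i < b.1 i)).card : ℝ) / n
      - ∏ i, b.1 i|) ⟨1, ?_⟩ ⟨b, hb⟩
  rintro _ ⟨c, rfl⟩
  have h₁ : (((Finset.range n).filter (fun j => ∀ i, 0 ≤ X j i ∧ X j i < c.1 i)).card : ℝ) / n
      ≤ 1 := by
    refine div_le_one_of_le₀ ?_ n.cast_nonneg
    exact_mod_cast (Finset.card_filter_le _ _).trans (Finset.card_range n).le
  have h₂ : ∏ i, c.1 i ≤ 1 := Finset.prod_le_one (fun i _ => c.2.1 i) fun i _ => c.2.2 i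
  have h₃ : 0 ≤ ∏ i, c.1 i := Finset.prod_nonneg fun i _ => c.2.1 i
  have h₄ : (0 : ℝ) ≤ (((Finset.range n).filter
    (fun j => ∀ i, 0 ≤ X j i ∧ X j i < c.1 i)).card : ℝ) / n := by positivity
  exact abs_le.2 ⟨by linarith, by linarith⟩

lemma starDiscrepancy_nonneg (X : ℕ → EuclideanSpace ℝ (Fin d)) (n : ℕ) :
    0 ≤ starDiscrepancy X n :=
  Real.iSup_nonneg fun _ => abs_nonneg _

/-- For $n\ge2$ the rate is nonzero, so finitely many initial terms can be absorbed into the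
asymptotic constant. -/
lemma IsLowDiscrepancy.exists_bound {X : ℕ → EuclideanSpace ℝ (Fin d)}
    (hX : IsLowDiscrepancy X) : ∃ C : ℝ, 0 < C ∧ ∀ n : ℕ, 2 ≤ n →
      starDiscrepancy X n ≤ C * ((n : ℝ)⁻¹ * Real.log n ^ d) := by
  obtain ⟨C, hC, h⟩ := bound_of_isBigO_nat_atTop hX.2
  refine ⟨C, hC, fun n hn => ?_⟩
  have hlog : 0 < Real.log n := Real.log_pos (by exact_mod_cast hn)
  have hn' : (0 : ℝ) < n := by exact_mod_cast (by omega : 0 < n)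
  have hpos : 0 < (n : ℝ)⁻¹ * Real.log n ^ d := by positivity
  have := h (x := n) hpos.ne'
  rw [Real.norm_of_nonneg hpos.le] at this
  exact (le_abs_self _).trans this

end Discrepancy

/-! ### The cube in Euclidean space and parameter integrals over it. -/

section Cube

variable {d : ℕ}

lemma preimage_toLp_unitCube :
    (WithLp.toLp 2 : (Fin d → ℝ) → EuclideanSpace ℝ (Fin d)) ⁻¹' unitCube d = Set.Icc 0 1 := by
  ext x
  simp [unitCube, Pi.le_def, forall_and]

lemma isCompact_unitCube : IsCompact (unitCube d) := by
  rw [← Set.image_preimage_eq (unitCube d) (WithLp.toLp_surjective 2), preimage_toLp_unitCube]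
  exact isCompact_Icc.image (PiLp.continuous_toLp 2 _)

lemma setIntegral_unitCube (f : EuclideanSpace ℝ (Fin d) → ℝ) :
    ∫ x in unitCube d, f x = ∫ x in Set.Icc (0 : Fin d → ℝ) 1, f (WithLp.toLp 2 x) := by
  rw [← preimage_toLp_unitCube]
  exact ((PiLp.volume_preserving_toLp (Fin d)).setIntegral_preimage_emb
    (MeasurableEquiv.toLp 2 (Fin d → ℝ)).measurableEmbedding f _).symm

lemma volume_real_unitCube : volume.real (unitCube d) = 1 := by
  have h := setIntegral_unitCube (d := d) fun _ => 1
  rw [setIntegral_const, setIntegral_const, smul_eq_mul, smul_eq_mul, mul_one, mul_one] at h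
  rw [h, Measure.real, Real.volume_Icc_pi_toReal zero_le_one]
  simp

/-- Dominated convergence, with a constant bound from compactness of `K` times the cube. -/
lemma continuousOn_setIntegral_unitCube {P : Type*} [TopologicalSpace P]
    [FirstCountableTopology P] {G : P × EuclideanSpace ℝ (Fin d) → ℝ}
    (hG : ContinuousOn G (Set.univ ×ˢ unitCube d)) {K : Set P} (hK : IsCompact K) :
    ContinuousOn (fun θ => ∫ x in unitCube d, G (θ, x)) K := by
  obtain ⟨M, hM⟩ := (hK.prod (isCompact_unitCube (d := d))).exists_bound_of_continuousOn
    (hG.mono (Set.prod_mono_left (Set.subset_univ K)))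
  have hmeas := (isCompact_unitCube (d := d)).measurableSet
  refine continuousOn_of_dominated (bound := fun _ => M) (fun θ hθ => ?_) (fun θ hθ => ?_) ?_ ?_
  · exact (hG.comp (by fun_prop) fun x hx => ⟨trivial, hx⟩).aestronglyMeasurable hmeas
  · filter_upwards [ae_restrict_mem hmeas] with x hx using hM (θ, x) ⟨hθ, hx⟩
  · exact integrableOn_const (isCompact_unitCube.measure_lt_top.ne)
  · filter_upwards [ae_restrict_mem hmeas] with x hx
    exact hG.comp (by fun_prop) fun θ _ => ⟨trivial, hx⟩

end Cube

/-! ### The uniform Koksma–Hlawka inequality on the closed cube. -/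

section KoksmaHlawka

variable {d : ℕ} {P : Type*} [NormedAddCommGroup P] [NormedSpace ℝ P]

lemma abs_average_le {M : ℝ} (n : ℕ) {a : ℕ → ℝ} (ha : ∀ j, |a j| ≤ M) :
    |1 / (n : ℝ) * ∑ j ∈ Finset.range n, a j| ≤ M := by
  rcases Nat.eq_zero_or_pos n with rfl | hn
  · simpa using (abs_nonneg _).trans (ha 0)
  have hn' : (0 : ℝ) < n := by exact_mod_cast hn
  rw [abs_mul, abs_of_nonneg (by positivity : (0 : ℝ) ≤ 1 / n), one_div, inv_mul_le_iff₀ hn']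
  refine (Finset.abs_sum_le_sum_abs _ _).trans ?_
  simpa using Finset.sum_le_sum fun j (_ : j ∈ Finset.range n) => ha j

/-- A Koksma–Hlawka inequality, uniform over compact parameter sets. -/
theorem exists_bound_integral_sub_average {G : P × EuclideanSpace ℝ (Fin d) → ℝ}
    (hG : ContDiffOn ℝ d G (Set.univ ×ˢ unitCube d)) {K : Set P} (hK : IsCompact K) :
    ∃ C : ℝ, 0 ≤ C ∧ ∀ X : ℕ → EuclideanSpace ℝ (Fin d), (∀ j, X j ∈ unitCube d) →
      ∀ n : ℕ, 0 < n → ∀ θ ∈ K,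
        |(∫ x in unitCube d, G (θ, x)) - 1 / (n : ℝ) * ∑ j ∈ Finset.range n, G (θ, X j)|
          ≤ C * starDiscrepancy X n := by
  obtain ⟨M, hM⟩ := (hK.prod (isCompact_unitCube (d := d))).exists_bound_of_continuousOn
    (hG.continuousOn.mono (Set.prod_mono_left (Set.subset_univ K)))
  set G' : P × (Fin d → ℝ) → ℝ := fun p => G (p.1, WithLp.toLp 2 p.2) with hG'
  have hG's : ContDiffOn ℝ (Finset.univ : Finset (Fin d)).card G'
      (Set.univ ×ˢ Set.Icc 0 1) := by
    rw [Finset.card_fin]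
    refine hG.comp (ContDiff.contDiffOn
      (contDiff_fst.prodMk (PiLp.contDiff_toLp.comp contDiff_snd))) fun p hp => ⟨trivial, ?_⟩
    rw [← preimage_toLp_unitCube] at hp
    exact hp.2
  obtain ⟨C, hC, h⟩ := exists_bound_setIntegral_sub_lowerBox hK Finset.univ G' hG's
  -- The box estimate misses sample points with some coordinate equal to `1`. The term `max M 0`
  -- pays for them.
  refine ⟨C + max M 0, by positivity, fun X hX n hn θ hθ => ?_⟩
  have hn' : (0 : ℝ) < n := by exact_mod_cast hn
  have hone : (1 : Fin d → ℝ) ∈ Set.Icc (0 : Fin d → ℝ) 1 := ⟨zero_le_one, le_rfl⟩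
  have : IsFiniteMeasure (volume.restrict (Set.Icc (0 : Fin d → ℝ) 1)) :=
    isFiniteMeasure_restrict.2 isCompact_Icc.measure_lt_top.ne
  have hdisc := fun b hb => abs_empiricalMeasure_sub_volume_lowerBox_le X n (b := b) hb
  have hbox := h _ _ _ hdisc θ hθ 0 ⟨le_rfl, zero_le_one⟩ 1 hone fun _ _ => rfl
  have hmass := hdisc 1 hone
  have hind := setIntegral_empiricalMeasure (fun j => (X j).ofLp) n (fun _ => 1)
    (measurableSet_lowerBox 1)
  rw [setIntegral_const, smul_eq_mul, mul_one] at hind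
  simp only [Finset.piecewise_univ] at hbox
  have hae : (lowerBox 1 : Set (Fin d → ℝ)) =ᵐ[volume] Set.Icc 0 1 :=
    Measure.univ_pi_Ico_ae_eq_Icc
  rw [Measure.restrict_restrict_of_subset (lowerBox_subset_Icc hone), setIntegral_congr_set hae,
    setIntegral_empiricalMeasure _ _ _ (measurableSet_lowerBox 1), abs_sub_comm] at hbox
  rw [measureReal_restrict_apply' measurableSet_Icc,
    Set.inter_eq_left.2 (lowerBox_subset_Icc hone), Measure.real, Measure.real,
    measure_congr hae, ← Measure.real, ← Measure.real, measureReal_def volume,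
    Real.volume_Icc_pi_toReal zero_le_one, hind] at hmass
  simp only [Pi.one_apply, Pi.zero_apply, sub_zero, Finset.prod_const_one] at hmass
  rw [setIntegral_unitCube, add_mul]
  refine (abs_sub_le _ (1 / (n : ℝ) * ∑ j ∈ Finset.range n,
    (lowerBox 1).indicator (fun x => G' (θ, x)) (X j).ofLp) _).trans (add_le_add hbox ?_)
  rw [← mul_sub, ← Finset.sum_sub_distrib]
  have hterm : ∀ j, |(lowerBox 1).indicator (fun x => G' (θ, x)) (X j).ofLp - G (θ, X j)|
      ≤ max M 0 * (1 - (lowerBox 1).indicator (fun _ => 1) (X j).ofLp) := by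
    intro j
    by_cases hj : (X j).ofLp ∈ lowerBox 1
    · simp [hj, hG']
    · simpa [hj] using Or.inl (hM (θ, X j) ⟨hθ, hX j⟩)
  calc |1 / (n : ℝ) * ∑ j ∈ Finset.range n,
        ((lowerBox 1).indicator (fun x => G' (θ, x)) (X j).ofLp - G (θ, X j))|
      ≤ 1 / (n : ℝ) * ∑ j ∈ Finset.range n,
          max M 0 * (1 - (lowerBox 1).indicator (fun _ => 1) (X j).ofLp) := by
        rw [abs_mul, abs_of_nonneg (by positivity : (0 : ℝ) ≤ 1 / n)]
        exact mul_le_mul_of_nonneg_left ((Finset.abs_sum_le_sum_abs _ _).trans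
          (Finset.sum_le_sum fun j _ => hterm j)) (by positivity)
    _ = max M 0 * (1 - 1 / (n : ℝ) * ∑ j ∈ Finset.range n,
          (lowerBox 1).indicator (fun _ => 1) (X j).ofLp) := by
        rw [← Finset.mul_sum, Finset.sum_sub_distrib]
        simp only [Finset.sum_const, Finset.card_range, nsmul_eq_mul, mul_one]
        field_simp
    -- The box $[0,1)^d$ has volume one, so the proportion of sample points outside it is at most
    -- the discrepancy.
    _ ≤ max M 0 * starDiscrepancy X n :=
        mul_le_mul_of_nonneg_left (by linarith [(abs_le.1 hmass).1]) (le_max_right _ _)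

end KoksmaHlawka

/-! ### Joint smoothness of networks in weights and input, and existence of minimizers. -/

lemma contDiff_swish {n : WithTop ℕ∞} : ContDiff ℝ n swish := by
  unfold swish
  exact contDiff_id.div (contDiff_const.add (Real.contDiff_exp.comp contDiff_neg))
    fun t => (by positivity)

namespace NetShape

variable {d : ℕ} (S : NetShape d)

lemma contDiff_affineLayer {n : WithTop ℕ∞} {E : Type*} [NormedAddCommGroup E] [NormedSpace ℝ E]
    {i : ℕ} (hi : i < S.hidden + 1) {θ : E → S.WeightIndex → ℝ} (hθ : ContDiff ℝ n θ)
    {s : E → Fin (S.width i) → ℝ} (hs : ∀ c, ContDiff ℝ n fun p => s p c)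
    (r : Fin (S.width (i + 1))) :
    ContDiff ℝ n fun p => S.affineLayer (θ p) i hi (s p) r := by
  have hθ' := contDiff_pi.1 hθ
  exact (ContDiff.sum fun c _ => (hθ' _).mul (hs c)).add (hθ' _)

lemma contDiff_preactivation {n : WithTop ℕ∞} :
    ∀ (i : ℕ) (hi : i < S.hidden + 1) (r : Fin (S.width (i + 1))),
      ContDiff ℝ n fun p : (S.WeightIndex → ℝ) × EuclideanSpace ℝ (Fin d) =>
        S.preactivation p.1 (fun c => p.2 (Fin.cast S.width_zero c)) i hi r
  | 0, hi, r => by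
    simp only [preactivation]
    refine S.contDiff_affineLayer hi contDiff_fst (fun c => ?_) r
    exact (contDiff_pi.1 (PiLp.contDiff_ofLp (p := 2) (E := fun _ : Fin d => ℝ)) _).comp
      contDiff_snd
  | i + 1, hi, r => by
    simp only [preactivation]
    exact S.contDiff_affineLayer hi contDiff_fst (fun c => contDiff_swish.comp
      (contDiff_preactivation i (Nat.lt_of_succ_lt hi) c)) r

lemma contDiff_realization {n : WithTop ℕ∞} :
    ContDiff ℝ n fun p : (S.WeightIndex → ℝ) × EuclideanSpace ℝ (Fin d) =>
      S.realization p.1 p.2 :=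
  S.contDiff_preactivation _ _ _

/-- The squared norm is a sum of squares of directional derivatives of a jointly smooth function;
one extra order of smoothness is spent on differentiating. -/
lemma contDiff_norm_gradient_realization_sq {n : ℕ} :
    ContDiff ℝ n fun p : (S.WeightIndex → ℝ) × EuclideanSpace ℝ (Fin d) =>
      ‖gradient (S.realization p.1) p.2‖ ^ 2 := by
  have hcoord : ∀ (p : (S.WeightIndex → ℝ) × EuclideanSpace ℝ (Fin d)) (i : Fin d),
      gradient (S.realization p.1) p.2 i
        = fderiv ℝ (S.realization p.1) p.2 (EuclideanSpace.single i 1) := by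
    intro p i
    rw [← inner_gradient_left, EuclideanSpace.inner_single_right]
    simp
  simp only [EuclideanSpace.real_norm_sq_eq, hcoord]
  refine ContDiff.sum fun i _ => ContDiff.pow ?_ 2
  refine ContDiff.fderiv_apply (m := (n + 1 : ℕ)) ?_ contDiff_snd contDiff_const (by norm_cast)
  exact S.contDiff_realization.comp
    ((contDiff_fst.comp contDiff_fst).prodMk contDiff_snd)

lemma nonempty_argminOn_netClass {B : ℝ} (hB : 0 < B)
    {J : (EuclideanSpace ℝ (Fin d) → ℝ) → ℝ}
    (hJ : ContinuousOn (fun θ => J (S.realization θ)) (Metric.closedBall 0 B)) :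
    (argminOn J (S.netClass B)).Nonempty := by
  obtain ⟨θ, hθ, hmin⟩ := (isCompact_closedBall (0 : S.WeightIndex → ℝ) B).exists_isMinOn
    ⟨0, Metric.mem_closedBall_self hB.le⟩ hJ
  refine ⟨S.realization θ, ⟨θ, mem_closedBall_zero_iff.1 hθ, rfl⟩, ?_⟩
  rintro _ ⟨θ', hθ', rfl⟩
  exact hmin (mem_closedBall_zero_iff.2 hθ')

end NetShape

lemma contDiffOn_comp_snd {d : ℕ} {P : Type*} [NormedAddCommGroup P] [NormedSpace ℝ P]
    {f : EuclideanSpace ℝ (Fin d) → ℝ} (hf : ContDiffOn ℝ d f (unitCube d)) :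
    ContDiffOn ℝ d (fun p : P × EuclideanSpace ℝ (Fin d) => f p.2)
      (Set.univ ×ˢ unitCube d) :=
  hf.comp contDiffOn_snd fun _ hp => hp.2

lemma continuous_of_continuousOn_univ_prod {P E : Type*} [TopologicalSpace P] [TopologicalSpace E]
    {G : P × E → ℝ} {s : Set E} (hG : ContinuousOn G (Set.univ ×ˢ s)) {x : E} (hx : x ∈ s) :
    Continuous fun θ => G (θ, x) :=
  hG.comp_continuous (by fun_prop) fun _ => ⟨trivial, hx⟩

lemma abs_half_sq_sub_half_sq_le {a b M : ℝ} (ha : |a| ≤ M) (hb : |b| ≤ M) :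
    |1 / 2 * a ^ 2 - 1 / 2 * b ^ 2| ≤ M * |a - b| := by
  have h : 1 / 2 * a ^ 2 - 1 / 2 * b ^ 2 = (a + b) / 2 * (a - b) := by ring
  rw [h, abs_mul]
  refine mul_le_mul_of_nonneg_right ?_ (abs_nonneg _)
  rw [abs_le] at *
  constructor <;> linarith

/-- A bound in terms of the star discrepancy that is uniform over the network class gives the
rate of a low-discrepancy sequence for all minimizers. -/
lemma exists_rate_of_uniform_bound {d : ℕ} {S : NetShape d} {B : ℝ}
    {X : ℕ → EuclideanSpace ℝ (Fin d)} (hX : IsLowDiscrepancy X)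
    {J : (EuclideanSpace ℝ (Fin d) → ℝ) → ℝ} {Jn : ℕ → (EuclideanSpace ℝ (Fin d) → ℝ) → ℝ}
    {C : ℝ} (hC : 0 ≤ C)
    (h : ∀ n : ℕ, 0 < n → ∀ θ ∈ Metric.closedBall (0 : S.WeightIndex → ℝ) B,
      |J (S.realization θ) - Jn n (S.realization θ)| ≤ C * starDiscrepancy X n) :
    ∃ μ : ℝ, 0 < μ ∧ ∀ n : ℕ, 2 ≤ n →
      (∀ u ∈ argminOn (Jn n) (S.netClass B), |J u - Jn n u| ≤ μ * (n : ℝ)⁻¹ * Real.log n ^ d) ∧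
      (∀ u ∈ argminOn J (S.netClass B), |J u - Jn n u| ≤ μ * (n : ℝ)⁻¹ * Real.log n ^ d) := by
  obtain ⟨D, hD, hrate⟩ := hX.exists_bound
  -- `C` may vanish; `C + 1` keeps the rate constant positive.
  refine ⟨(C + 1) * D, by positivity, fun n hn => ?_⟩
  have key : ∀ u ∈ S.netClass B,
      |J u - Jn n u| ≤ (C + 1) * D * (n : ℝ)⁻¹ * Real.log n ^ d := by
    rintro _ ⟨θ, hθ, rfl⟩
    calc |J (S.realization θ) - Jn n (S.realization θ)|
        ≤ C * starDiscrepancy X n := h n (by omega) θ (mem_closedBall_zero_iff.2 hθ)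
      _ ≤ (C + 1) * (D * ((n : ℝ)⁻¹ * Real.log n ^ d)) :=
          mul_le_mul (by linarith) (hrate n hn) (starDiscrepancy_nonneg X n) (by linarith)
      _ = (C + 1) * D * (n : ℝ)⁻¹ * Real.log n ^ d := by ring
  exact ⟨fun u hu => key u hu.1, fun u hu => key u hu.1⟩

/-! ### The Poisson and Schrödinger losses. -/

section Losses

variable {d : ℕ} (S : NetShape d)

lemma contDiffOn_poisson_integrand {f : EuclideanSpace ℝ (Fin d) → ℝ}
    (hf : ContDiffOn ℝ d f (unitCube d)) :
    ContDiffOn ℝ d (fun p : (S.WeightIndex → ℝ) × EuclideanSpace ℝ (Fin d) =>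
      1 / 2 * ‖gradient (S.realization p.1) p.2‖ ^ 2 - f p.2 * S.realization p.1 p.2)
      (Set.univ ×ˢ unitCube d) :=
  (contDiffOn_const.mul S.contDiff_norm_gradient_realization_sq.contDiffOn).sub
    ((contDiffOn_comp_snd hf).mul S.contDiff_realization.contDiffOn)

lemma contDiffOn_schrodinger_integrand {V g : EuclideanSpace ℝ (Fin d) → ℝ}
    (hV : ContDiffOn ℝ d V (unitCube d)) (hg : ContDiffOn ℝ d g (unitCube d)) :
    ContDiffOn ℝ d (fun p : (S.WeightIndex → ℝ) × EuclideanSpace ℝ (Fin d) =>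
      1 / 2 * ‖gradient (S.realization p.1) p.2‖ ^ 2
        + 1 / 2 * V p.2 * |S.realization p.1 p.2| ^ 2 - g p.2 * S.realization p.1 p.2)
      (Set.univ ×ˢ unitCube d) := by
  simp only [sq_abs]
  exact ((contDiffOn_const.mul S.contDiff_norm_gradient_realization_sq.contDiffOn).add
    ((contDiffOn_const.mul (contDiffOn_comp_snd hV)).mul
      (S.contDiff_realization.contDiffOn.pow 2))).sub
    ((contDiffOn_comp_snd hg).mul S.contDiff_realization.contDiffOn)

lemma empiricalSchrodingerLoss_eq (X : ℕ → EuclideanSpace ℝ (Fin d)) (n : ℕ)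
    (V g u : EuclideanSpace ℝ (Fin d) → ℝ) :
    empiricalSchrodingerLoss X n V g u = 1 / (n : ℝ) * ∑ j ∈ Finset.range n,
      (1 / 2 * ‖gradient u (X j)‖ ^ 2 + 1 / 2 * V (X j) * |u (X j)| ^ 2 - g (X j) * u (X j)) := by
  simp only [empiricalSchrodingerLoss, sub_add_eq_add_sub]

theorem exists_bound_poissonLoss_sub {f : EuclideanSpace ℝ (Fin d) → ℝ}
    (hf : ContDiffOn ℝ d f (unitCube d)) (B : ℝ) :
    ∃ C : ℝ, 0 ≤ C ∧ ∀ X : ℕ → EuclideanSpace ℝ (Fin d), (∀ j, X j ∈ unitCube d) →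
      ∀ n : ℕ, 0 < n → ∀ θ ∈ Metric.closedBall (0 : S.WeightIndex → ℝ) B,
        |poissonLoss f (S.realization θ) - empiricalPoissonLoss X n f (S.realization θ)|
          ≤ C * starDiscrepancy X n := by
  have hK := isCompact_closedBall (0 : S.WeightIndex → ℝ) B
  have hu : ContDiff ℝ d _ := S.contDiff_realization
  obtain ⟨C₁, hC₁, h₁⟩ :=
    exists_bound_integral_sub_average (contDiffOn_poisson_integrand S hf) hK
  obtain ⟨C₂, hC₂, h₂⟩ :=
    exists_bound_integral_sub_average (d := d) hu.contDiffOn hK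
  obtain ⟨M, hM⟩ := (hK.prod (isCompact_unitCube (d := d))).exists_bound_of_continuousOn
    hu.continuous.continuousOn
  -- Both the mean over the cube and the sample mean of the network are at most `max M 0` in
  -- absolute value, which is thus a Lipschitz constant for half the square.
  refine ⟨C₁ + max M 0 * C₂, by positivity, fun X hX n hn θ hθ => ?_⟩
  rw [poissonLoss, empiricalPoissonLoss, add_sub_add_comm, add_mul, mul_assoc]
  refine (abs_add_le _ _).trans (add_le_add (h₁ X hX n hn θ hθ) ?_)
  refine (abs_half_sq_sub_half_sq_le (M := max M 0) ?_ ?_).trans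
    (mul_le_mul_of_nonneg_left (h₂ X hX n hn θ hθ) (le_max_right _ _))
  · refine le_trans ?_ (le_max_left _ _)
    have := norm_setIntegral_le_of_norm_le_const (μ := volume) (s := unitCube d)
      (f := S.realization θ) isCompact_unitCube.measure_lt_top fun x hx => hM (θ, x) ⟨hθ, hx⟩
    rwa [volume_real_unitCube, mul_one] at this
  · exact abs_average_le n fun j => (hM (θ, X j) ⟨hθ, hX j⟩).trans (le_max_left _ _)

theorem exists_bound_schrodingerLoss_sub {V g : EuclideanSpace ℝ (Fin d) → ℝ}
    (hV : ContDiffOn ℝ d V (unitCube d)) (hg : ContDiffOn ℝ d g (unitCube d)) (B : ℝ) :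
    ∃ C : ℝ, 0 ≤ C ∧ ∀ X : ℕ → EuclideanSpace ℝ (Fin d), (∀ j, X j ∈ unitCube d) →
      ∀ n : ℕ, 0 < n → ∀ θ ∈ Metric.closedBall (0 : S.WeightIndex → ℝ) B,
        |schrodingerLoss V g (S.realization θ) - empiricalSchrodingerLoss X n V g (S.realization θ)|
          ≤ C * starDiscrepancy X n := by
  simp only [empiricalSchrodingerLoss_eq]
  exact exists_bound_integral_sub_average (contDiffOn_schrodinger_integrand S hV hg)
    (isCompact_closedBall _ _)

lemma continuousOn_poissonLoss_realization {f : EuclideanSpace ℝ (Fin d) → ℝ}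
    (hf : ContDiffOn ℝ d f (unitCube d)) (B : ℝ) :
    ContinuousOn (fun θ => poissonLoss f (S.realization θ)) (Metric.closedBall 0 B) := by
  have hK := isCompact_closedBall (0 : S.WeightIndex → ℝ) B
  have hu : ContDiff ℝ d _ := S.contDiff_realization
  exact (continuousOn_setIntegral_unitCube (contDiffOn_poisson_integrand S hf).continuousOn hK).add
    (continuousOn_const.mul
      ((continuousOn_setIntegral_unitCube (d := d) hu.continuous.continuousOn hK).pow 2))

lemma continuous_empiricalPoissonLoss_realization {f : EuclideanSpace ℝ (Fin d) → ℝ}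
    (hf : ContDiffOn ℝ d f (unitCube d)) {X : ℕ → EuclideanSpace ℝ (Fin d)}
    (hX : ∀ j, X j ∈ unitCube d) (n : ℕ) :
    Continuous fun θ => empiricalPoissonLoss X n f (S.realization θ) := by
  have hu : ContDiff ℝ d _ := S.contDiff_realization
  refine (continuous_const.mul (continuous_finsetSum _ fun j _ => ?_)).add
    (continuous_const.mul ((continuous_const.mul (continuous_finsetSum _ fun j _ => ?_)).pow 2))
  · exact continuous_of_continuousOn_univ_prod
      (contDiffOn_poisson_integrand S hf).continuousOn (hX j)
  · exact continuous_of_continuousOn_univ_prod hu.continuous.continuousOn (hX j)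

lemma continuous_empiricalSchrodingerLoss_realization {V g : EuclideanSpace ℝ (Fin d) → ℝ}
    (hV : ContDiffOn ℝ d V (unitCube d)) (hg : ContDiffOn ℝ d g (unitCube d))
    {X : ℕ → EuclideanSpace ℝ (Fin d)} (hX : ∀ j, X j ∈ unitCube d) (n : ℕ) :
    Continuous fun θ => empiricalSchrodingerLoss X n V g (S.realization θ) := by
  simp only [empiricalSchrodingerLoss_eq]
  exact continuous_const.mul (continuous_finsetSum _ fun j _ =>
    continuous_of_continuousOn_univ_prod
      (contDiffOn_schrodinger_integrand S hV hg).continuousOn (hX j))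

end Losses

theorem theorem3p2 {d : ℕ} (S : NetShape d) (B : ℝ) (hB : 0 < B)
    (X : ℕ → EuclideanSpace ℝ (Fin d)) (hX : IsLowDiscrepancy X) :
    (∀ f : EuclideanSpace ℝ (Fin d) → ℝ, ContDiffOn ℝ d f (unitCube d) →
      (argminOn (poissonLoss f) (S.netClass B)).Nonempty ∧
      (∀ n : ℕ, 2 ≤ n → (argminOn (empiricalPoissonLoss X n f) (S.netClass B)).Nonempty) ∧
      ∃ μ₁ : ℝ, 0 < μ₁ ∧ ∀ n : ℕ, 2 ≤ n →
        (∀ u ∈ argminOn (empiricalPoissonLoss X n f) (S.netClass B),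
          |poissonLoss f u - empiricalPoissonLoss X n f u|
            ≤ μ₁ * (n : ℝ)⁻¹ * Real.log n ^ d) ∧
        (∀ u ∈ argminOn (poissonLoss f) (S.netClass B),
          |poissonLoss f u - empiricalPoissonLoss X n f u|
            ≤ μ₁ * (n : ℝ)⁻¹ * Real.log n ^ d)) ∧
    (∀ V g : EuclideanSpace ℝ (Fin d) → ℝ,
      ContDiffOn ℝ d V (unitCube d) → ContDiffOn ℝ d g (unitCube d) →
      (argminOn (schrodingerLoss V g) (S.netClass B)).Nonempty ∧
      (∀ n : ℕ, 2 ≤ n → (argminOn (empiricalSchrodingerLoss X n V g) (S.netClass B)).Nonempty) ∧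
      ∃ μ₂ : ℝ, 0 < μ₂ ∧ ∀ n : ℕ, 2 ≤ n →
        (∀ u ∈ argminOn (empiricalSchrodingerLoss X n V g) (S.netClass B),
          |schrodingerLoss V g u - empiricalSchrodingerLoss X n V g u|
            ≤ μ₂ * (n : ℝ)⁻¹ * Real.log n ^ d) ∧
        (∀ u ∈ argminOn (schrodingerLoss V g) (S.netClass B),
          |schrodingerLoss V g u - empiricalSchrodingerLoss X n V g u|
            ≤ μ₂ * (n : ℝ)⁻¹ * Real.log n ^ d)) := by
  refine ⟨fun f hf => ⟨?_, fun n _ => ?_, ?_⟩, fun V g hV hg => ⟨?_, fun n _ => ?_, ?_⟩⟩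
  · exact S.nonempty_argminOn_netClass hB (continuousOn_poissonLoss_realization S hf B)
  · exact S.nonempty_argminOn_netClass hB
      (continuous_empiricalPoissonLoss_realization S hf hX.1 n).continuousOn
  · obtain ⟨C, hC, h⟩ := exists_bound_poissonLoss_sub S hf B
    exact exists_rate_of_uniform_bound hX hC (h X hX.1)
  · exact S.nonempty_argminOn_netClass hB (continuousOn_setIntegral_unitCube
      (contDiffOn_schrodinger_integrand S hV hg).continuousOn (isCompact_closedBall _ _))
  · exact S.nonempty_argminOn_netClass hB
      (continuous_empiricalSchrodingerLoss_realization S hV hg hX.1 n).continuousOn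
  · obtain ⟨C, hC, h⟩ := exists_bound_schrodingerLoss_sub S hV hg B
    exact exists_rate_of_uniform_bound hX hC (h X hX.1)
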